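/- Let $d,L\ge 1$ be integers, $1\le\alpha<\infty$ and $C\ge 0$. Write $\|\cdot\|_\alpha$ for the entrywise $\ell_\alpha$ norm on $\mathbb{R}^{d\times L}$. Let $\mathcal F_C$ be the set of maps $f:[0,1]^{d\times L}\to[0,1]^{d\times L}$ with $\|f(Z)-f(Z')\|_\alpha\le C\|Z-Z'\|_\alpha$ for all $Z,Z'$, and put $$d_\alpha(f_1,f_2)=\Big(\int_{[0,1]^{d\times L}}\|f_1(Z)-f_2(Z)\|_\alpha^\alpha\,dZ\Big)^{1/\alpha}.$$ A feed-forward (FF) layer with $r$ neurons is a map $\mathbb{R}^{d\times L}\to\mathbb{R}^{d\times L}$ acting on each column (token) by $z\mapsto z+W^{(2)}\mathrm{ReLU}(W^{(1)}z+b^{(1)})+b^{(2)}$, with $W^{(1)}\in\mathbb{R}^{r\times d}$, $b^{(1)}\in\mathbb{R}^r$, $W^{(2)}\in\mathbb{R}^{d\times r}$, $b^{(2)}\in\mathbb{R}^d$. A single-head self-attention layer of size $s$ is a map $$Z_{:,k}\mapsto Z_{:,k}+W_O(W_VZ)\,\mathrm{Softmax}\big[(W_KZ)^\top(W_QZ_{:,k})\big],\qquad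 k=1,\dots,L,$$ with $W_O\in\mathbb{R}^{d\times s}$ and $W_V,W_K,W_Q\in\mathbb{R}^{s\times d}$. Let $\mathcal T_A^{1,s,4}$ be the class of compositions of finitely many FF layers with $4$ neurons, one single-head self-attention layer of size $s$, and again finitely many FF layers with $4$ neurons. Let $\mathcal T_B^{1,s,r}$ be the class of compositions of one FF layer with $r$ neurons, one single-head self-attention layer of size $s$, and one FF layer with $r$ neurons. A positional embedding $E\in\mathbb{R}^{d\times L}$ is added to the input. **Theorem.** There are functions $N,r:(0,\infty)\to\mathbb{N}$, depending only on $d,L,\alpha,C$, with $N(\epsilon)=\mathcal O((1/\epsilon)^{dL})$ and $r(\epsilon)=\mathcal O((1/\epsilon)^{dL})$ as $\epsilon\to0^+$, such that for every $\epsilon>0$, every $f\in\mathcal F_C$, every head size $s\ge 1$ and any prescribed ranks $\rho_O,\rho_V,\rho_K,\rho_Q\in\{1,\dots,\min(d,s)\}$: 1. there are $\tau\in\mathcal T_A^{1,s,4}$ with at most $N(\epsilon)$ FF layers in total and $E\in\mathbb{R}^{d\times L}$ such that the attention weights $W_O,W_V,W_K,W_Q$ of $\tau$ have ranks exactly $\rho_O,\rho_V,\rho_K,\rho_Q$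 and $d_\alpha(\tau(\cdot+E),f)\le\epsilon$; 2. there are $\tau\in\mathcal T_B^{1,s,r(\epsilon)}$ and $E\in\mathbb{R}^{d\times L}$ such that the attention weights $W_O,W_V,W_K,W_Q$ of $\tau$ have ranks exactly $\rho_O,\rho_V,\rho_K,\rho_Q$ and $d_\alpha(\tau(\cdot+E),f)\le\epsilon$. For $s=1$ (all ranks equal to $1$) these are transformers in $\mathcal T_A^{1,1,4}$ and $\mathcal T_B^{1,1,r(\epsilon)}$. -/

import Mathlib

open MeasureTheory Asymptotics Filter Topology
open scoped Matrix ENNReal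

noncomputable section

namespace AnyRankAttention

/-- The `r`-neuron feed-forward layer acting on tokens in `ℝ^d`: weights and biases. -/
structure FeedForward (d r : ℕ) where
  W₁ : Matrix (Fin r) (Fin d) ℝ
  b₁ : Fin r → ℝ
  W₂ : Matrix (Fin d) (Fin r) ℝ
  b₂ : Fin d → ℝ

/-- Token-wise action `Z_{:,k} ↦ Z_{:,k} + W₂ ReLU(W₁ Z_{:,k} + b₁) + b₂`. -/
def FeedForward.eval {d r L : ℕ} (F : FeedForward d r) (Z : Matrix (Fin d) (Fin L) ℝ) :
    Matrix (Fin d) (Fin L) ℝ :=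
  Matrix.of fun i k =>
    Z i k + (F.W₂ *ᵥ fun j => max ((F.W₁ *ᵥ Z.col k + F.b₁) j) 0) i + F.b₂ i

/-- The action of a list of feed-forward layers; the head of the list is applied first
and the empty list is the identity. -/
def evalLayers {d r L : ℕ} (l : List (FeedForward d r)) (Z : Matrix (Fin d) (Fin L) ℝ) :
    Matrix (Fin d) (Fin L) ℝ :=
  l.foldl (fun Y F => F.eval Y) Z

/-- The softmax of a vector. -/
def softmax {L : ℕ} (v : Fin L → ℝ) : Fin L → ℝ :=
  fun j => Real.exp (v j) / ∑ l, Real.exp (v l)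

/-- A single attention head of hidden size `s` on tokens in `ℝ^d`: its weight matrices. -/
structure AttentionHead (d s : ℕ) where
  WO : Matrix (Fin d) (Fin s) ℝ
  WV : Matrix (Fin s) (Fin d) ℝ
  WK : Matrix (Fin s) (Fin d) ℝ
  WQ : Matrix (Fin s) (Fin d) ℝ

/-- The size-`s` attention output `(W_V Z) Softmax[(W_K Z)ᵀ (W_Q z)]` for the query token `z`. -/
def AttentionHead.att {d s L : ℕ} (A : AttentionHead d s) (z : Fin d → ℝ)
    (Z : Matrix (Fin d) (Fin L) ℝ) : Fin s → ℝ :=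
  (A.WV * Z) *ᵥ softmax ((A.WK * Z)ᵀ *ᵥ (A.WQ *ᵥ z))

/-- The single-head self-attention layer
`Z_{:,k} ↦ Z_{:,k} + W_O (W_V Z) Softmax[(W_K Z)ᵀ (W_Q Z_{:,k})]`. -/
def AttentionHead.eval {d s L : ℕ} (A : AttentionHead d s) (Z : Matrix (Fin d) (Fin L) ℝ) :
    Matrix (Fin d) (Fin L) ℝ :=
  Matrix.of fun i k => Z i k + (A.WO *ᵥ A.att (Z.col k) Z) i

/-- The weight matrices of the head have the prescribed ranks. -/
def AttentionHead.HasRanks {d s : ℕ} (A : AttentionHead d s) (ρO ρV ρK ρQ : ℕ) : Prop :=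
  A.WO.rank = ρO ∧ A.WV.rank = ρV ∧ A.WK.rank = ρK ∧ A.WQ.rank = ρQ

/-- The class `T_A^{1,s,r}`: feed-forward layers with `r` neurons each, then one single-head
self-attention layer of size `s`, then further feed-forward layers with `r` neurons each. -/
structure TransformerA (d s r : ℕ) where
  pre : List (FeedForward d r)
  head : AttentionHead d s
  post : List (FeedForward d r)

def TransformerA.eval {d s r L : ℕ} (τ : TransformerA d s r) (Z : Matrix (Fin d) (Fin L) ℝ) :
    Matrix (Fin d) (Fin L) ℝ :=
  evalLayers τ.post (τ.head.eval (evalLayers τ.pre Z))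

/-- The total number of feed-forward layers. -/
def TransformerA.numFF {d s r : ℕ} (τ : TransformerA d s r) : ℕ :=
  τ.pre.length + τ.post.length

/-- The class `T_B^{1,s,r}`: one feed-forward layer with `r` neurons, one single-head
self-attention layer of size `s`, and one further feed-forward layer with `r` neurons. -/
structure TransformerB (d s r : ℕ) where
  ff₁ : FeedForward d r
  head : AttentionHead d s
  ff₂ : FeedForward d r

def TransformerB.eval {d s r L : ℕ} (τ : TransformerB d s r) (Z : Matrix (Fin d) (Fin L) ℝ) :
    Matrix (Fin d) (Fin L) ℝ :=
  τ.ff₂.eval (τ.head.eval (τ.ff₁.eval Z))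

/-- The entrywise `ℓ_α` norm of a matrix. -/
def alphaNorm {d L : ℕ} (α : ℝ) (Z : Matrix (Fin d) (Fin L) ℝ) : ℝ :=
  (∑ i, ∑ k, |Z i k| ^ α) ^ (1 / α)

/-- The cube `[0,1]^{d × L}`. -/
def cube (d L : ℕ) : Set (Matrix (Fin d) (Fin L) ℝ) :=
  {Z | ∀ i k, Z i k ∈ Set.Icc (0 : ℝ) 1}

/-- The target class `F_C`: maps `[0,1]^{d × L} → [0,1]^{d × L}` that are `C`-Lipschitz in the
entrywise `ℓ_α` norm (the values of `f` off the cube play no role). -/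
def IsTarget {d L : ℕ} (α C : ℝ) (f : Matrix (Fin d) (Fin L) ℝ → Matrix (Fin d) (Fin L) ℝ) :
    Prop :=
  Set.MapsTo f (cube d L) (cube d L) ∧
    ∀ Z ∈ cube d L, ∀ Z' ∈ cube d L, alphaNorm α (f Z - f Z') ≤ C * alphaNorm α (Z - Z')

/-- `d_α(f₁, f₂) = (∫_{[0,1]^{d × L}} ‖f₁(Z) - f₂(Z)‖_α^α dZ)^{1/α}`, with respect to Lebesgue
measure on `ℝ^{d × L}`, as an extended nonnegative real. -/
def dAlpha {d L : ℕ} (α : ℝ)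
    (f₁ f₂ : Matrix (Fin d) (Fin L) ℝ → Matrix (Fin d) (Fin L) ℝ) : ℝ≥0∞ :=
  (∫⁻ X : Fin d → Fin L → ℝ in {X | Matrix.of X ∈ cube d L},
    ENNReal.ofReal (alphaNorm α (f₁ (Matrix.of X) - f₂ (Matrix.of X)) ^ α)) ^ (1 / α)

end AnyRankAttention

end

noncomputable section

namespace AnyRankAttention

variable {d L : ℕ}

/-! The layers before attention compress each token to one integer, a single head turns that integer
into a real number identifying the whole input cell, and the layers after it look the answer up.

Cut the cube into cells of side `1 / G` with `G` of order `1 / ε`. The embedding moves token `k`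
into `[k + 3, k + 4]`, so that values also reveal positions. Away from bands of width `η`, a
piecewise linear staircase rounds each coordinate to the grid, and a base `(L + 3) * G` expansion
packs the token into an integer `label` in the first coordinate. This costs `O(G)` layers or
neurons.

On such tokens a head sees only the top left entries of its weights, so any positive ranks will do.
The label `x` is sent to `x + c * B`, where `B` is a softmax average of the labels. With `w = exp (κ
* x)` and `P = ∑ X ^ a j` over the labels `a j`, this average is `w * P'(w) / P(w)`. If `exp κ` is
transcendental, equal averages at the same query force `P' * Q = Q' * P` and hence `P = Q`
(`range_eq_of_boltzmann_eq`). A generic `c` then makes the output injective in position and cell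
(`exists_separating_attention`).

There remain `L * G ^ (d * L)` distinct nodes on a line, which tents interpolate to the columns of
`f (corner g)`. This dominates the cost. Inside cells the error is controlled by the Lipschitz
bound. On the bands the output is merely bounded, and `η`, chosen last, makes their contribution
small (`dAlpha_le_of_cells`, `exists_head_and_nodes`). -/

/-- The action of a feed-forward layer on a single token. -/
def FeedForward.act {r : ℕ} (F : FeedForward d r) (z : Fin d → ℝ) : Fin d → ℝ :=
  z + F.W₂ *ᵥ (fun j => max ((F.W₁ *ᵥ z + F.b₁) j) 0) + F.b₂

/-- The action of a list of feed-forward layers on a single token. -/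
def actLayers {r : ℕ} (l : List (FeedForward d r)) (z : Fin d → ℝ) : Fin d → ℝ :=
  l.foldl (fun y F => F.act y) z

/-- Apply a map of tokens to every column. -/
def mapCols (P : (Fin d → ℝ) → Fin d → ℝ) (Z : Matrix (Fin d) (Fin L) ℝ) :
    Matrix (Fin d) (Fin L) ℝ :=
  Matrix.of fun i k => P (Z.col k) i

lemma FeedForward.eval_eq_mapCols {r : ℕ} (F : FeedForward d r) (Z : Matrix (Fin d) (Fin L) ℝ) :
    F.eval Z = mapCols F.act Z := by
  ext i k
  simp [FeedForward.eval, mapCols, FeedForward.act, Matrix.col]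

lemma mapCols_mapCols (P Q : (Fin d → ℝ) → Fin d → ℝ) (Z : Matrix (Fin d) (Fin L) ℝ) :
    mapCols P (mapCols Q Z) = mapCols (fun z => P (Q z)) Z := rfl

lemma evalLayers_eq_mapCols {r : ℕ} (l : List (FeedForward d r)) (Z : Matrix (Fin d) (Fin L) ℝ) :
    evalLayers l Z = mapCols (actLayers l) Z := by
  induction l generalizing Z with
  | nil => rfl
  | cons F l ih =>
    have : evalLayers (F :: l) Z = evalLayers l (F.eval Z) := rfl
    rw [this, ih, F.eval_eq_mapCols, mapCols_mapCols]
    rfl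

lemma FeedForward.continuous_act {r : ℕ} (F : FeedForward d r) : Continuous F.act := by
  have h : Continuous fun z : Fin d → ℝ => F.W₁ *ᵥ z + F.b₁ :=
    (Continuous.matrix_mulVec continuous_const continuous_id).add continuous_const
  refine (continuous_id.add (Continuous.matrix_mulVec continuous_const ?_)).add continuous_const
  exact continuous_pi fun j => ((continuous_apply j).comp h).max continuous_const

lemma continuous_actLayers {r : ℕ} (l : List (FeedForward d r)) : Continuous (actLayers l) := by
  induction l with
  | nil => exact continuous_id
  | cons F l ih => exact ih.comp F.continuous_act

/-- Finitely many neurons, each reading a single coordinate, form a feed-forward layer. -/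
lemma exists_feedForward {ι : Type*} [Fintype ι] {r : ℕ} (h : Fintype.card ι ≤ r)
    (c : ι → Fin d) (β : ι → ℝ) (u : ι → Fin d → ℝ) :
    ∃ F : FeedForward d r, ∀ z, F.act z = z + ∑ j, max (z (c j) - β j) 0 • u j := by
  classical
  obtain ⟨e⟩ : Nonempty (ι ↪ Fin r) :=
    Function.Embedding.nonempty_of_card_le (by simpa using h)
  -- Neurons outside the range of `e` get the default `0`, in particular zero output weights, so
  -- surplus width is harmless.
  refine ⟨⟨Matrix.of (Function.extend e (fun x => Pi.single (c x) 1) 0),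
    Function.extend e (fun x => -β x) 0,
    (Matrix.of (Function.extend e u 0))ᵀ, 0⟩, fun z => ?_⟩
  ext i
  simp only [FeedForward.act, Pi.add_apply, add_zero, Pi.zero_apply, Finset.sum_apply,
    Pi.smul_apply, smul_eq_mul, add_right_inj]
  simp only [Matrix.mulVec, dotProduct, Matrix.transpose_apply, Matrix.of_apply]
  symm
  refine Fintype.sum_of_injective e e.injective _ _ (fun j hj => ?_) (fun x => ?_)
  · rw [Function.extend_apply' _ _ _ (by simpa using hj)]
    simp
  · simp only [e.injective.extend_apply]
    simp [Pi.single_apply, mul_comm, sub_eq_add_neg]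

/-! ### Ranks of rectangular identities -/

/-- The `a × b` matrix with `ρ` diagonal entries equal to `c`. -/
def rectId (a b ρ : ℕ) (c : ℝ) : Matrix (Fin a) (Fin b) ℝ :=
  Matrix.of fun i j => if i.val = j.val ∧ i.val < ρ then c else 0

lemma rectId_mul_rectId (a b n ρ : ℕ) (hn : ρ ≤ n) (c e : ℝ) :
    rectId a n ρ c * rectId n b ρ e = rectId a b ρ (c * e) := by
  ext i j
  simp only [rectId, Matrix.mul_apply, Matrix.of_apply]
  by_cases hi : i.val < ρ
  · rw [Finset.sum_eq_single ⟨i.val, hi.trans_le hn⟩]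
    · simp [hi]
    · intro x _ hx
      rw [if_neg, zero_mul]
      rintro ⟨h, -⟩
      exact hx (Fin.ext h.symm)
    · simp
  · simp [hi]

/-- The matrix factors through dimension `ρ`, and conversely the identity of size `ρ` factors
through it. -/
lemma rank_rectId {a b ρ : ℕ} (ha : ρ ≤ a) (hb : ρ ≤ b) {c : ℝ} (hc : c ≠ 0) :
    (rectId a b ρ c).rank = ρ := by
  apply le_antisymm
  · have h := rectId_mul_rectId a b ρ ρ le_rfl c 1
    rw [mul_one] at h
    rw [← h]
    exact (Matrix.rank_mul_le_right _ _).trans ((Matrix.rank_le_height _))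
  · have h1 : rectId ρ a ρ c⁻¹ * (rectId a b ρ c * rectId b ρ ρ 1) = 1 := by
      rw [rectId_mul_rectId _ _ _ _ hb, rectId_mul_rectId _ _ _ _ ha]
      ext i j
      simp [rectId, Matrix.one_apply, Fin.ext_iff, hc]
    have h2 := Matrix.rank_one (R := ℝ) (n := Fin ρ)
    rw [← h1, Fintype.card_fin] at h2
    calc ρ = _ := h2.symm
      _ ≤ _ := Matrix.rank_mul_le_right _ _
      _ ≤ _ := Matrix.rank_mul_le_left _ _

/-! ### The attention layer on tokens in the first coordinate -/

/-- The token matrix with first row `t` and all other entries zero. -/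
def firstRow [NeZero d] (t : Fin L → ℝ) : Matrix (Fin d) (Fin L) ℝ :=
  Matrix.of fun i k => (Pi.single 0 (t k) : Fin d → ℝ) i

/-- The softmax average of `t` with weights `exp (κ * x * t j)`. -/
def boltzmann (κ : ℝ) (t : Fin L → ℝ) (x : ℝ) : ℝ :=
  (∑ j, t j * Real.exp (κ * t j * x)) / ∑ j, Real.exp (κ * t j * x)

/-- An attention head that acts on the first coordinate only, with prescribed ranks. -/
def diagHead (d s ρO ρV ρK ρQ : ℕ) (κ c : ℝ) : AttentionHead d s where
  WO := rectId d s ρO c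
  WV := rectId s d ρV 1
  WK := rectId s d ρK κ
  WQ := rectId s d ρQ 1

lemma diagHead_hasRanks {s ρO ρV ρK ρQ : ℕ} {κ c : ℝ} (hκ : κ ≠ 0) (hc : c ≠ 0)
    (hO : ρO ≤ min d s) (hV : ρV ≤ min d s) (hK : ρK ≤ min d s) (hQ : ρQ ≤ min d s) :
    (diagHead d s ρO ρV ρK ρQ κ c).HasRanks ρO ρV ρK ρQ := by
  rw [le_min_iff] at hO hV hK hQ
  exact ⟨rank_rectId hO.1 hO.2 hc, rank_rectId hV.2 hV.1 one_ne_zero,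
    rank_rectId hK.2 hK.1 hκ, rank_rectId hQ.2 hQ.1 one_ne_zero⟩

lemma rectId_mulVec_single {a b ρ : ℕ} [NeZero a] [NeZero b] (hρ : 1 ≤ ρ) (c x : ℝ) :
    rectId a b ρ c *ᵥ Pi.single 0 x = Pi.single 0 (c * x) := by
  ext i
  rw [Matrix.mulVec_single]
  by_cases hi : i = 0
  · subst hi
    simp [rectId, Matrix.col, Nat.pos_of_ne_zero (Nat.one_le_iff_ne_zero.mp hρ)]
  · have : i.val ≠ 0 := fun h => hi (Fin.ext h)
    simp [rectId, Matrix.col, hi, this]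

lemma rectId_mul_firstRow {a ρ : ℕ} [NeZero a] [NeZero d] (hρ : 1 ≤ ρ) (c : ℝ) (t : Fin L → ℝ) :
    rectId a d ρ c * (firstRow t : Matrix (Fin d) (Fin L) ℝ) = firstRow fun k => c * t k := by
  ext i k
  exact congrFun (rectId_mulVec_single (a := a) (b := d) hρ c (t k)) i

/-- All tokens are multiples of the first basis vector, so only the top left entries of the weights
act. The remaining diagonal entries adjust the ranks for free. -/
lemma diagHead_eval_firstRow [NeZero d] {s ρO ρV ρK ρQ : ℕ} [NeZero s] (κ c : ℝ)
    (hO : 1 ≤ ρO) (hV : 1 ≤ ρV) (hK : 1 ≤ ρK) (hQ : 1 ≤ ρQ) (t : Fin L → ℝ) :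
    (diagHead d s ρO ρV ρK ρQ κ c).eval (firstRow t) =
      firstRow fun k => t k + c * boltzmann κ t (t k) := by
  ext i k
  have hcol : (firstRow t : Matrix (Fin d) (Fin L) ℝ).col k = Pi.single 0 (t k) := by
    ext i; rfl
  have hscore : ((firstRow fun k => κ * t k : Matrix (Fin s) (Fin L) ℝ))ᵀ *ᵥ
      (Pi.single 0 (1 * t k)) = fun j => κ * t j * t k := by
    rw [Matrix.mulVec_single]
    ext j
    simp [Matrix.col, firstRow, mul_comm]
  have hatt : (diagHead d s ρO ρV ρK ρQ κ c).att (Pi.single 0 (t k)) (firstRow t) =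
      Pi.single 0 (boltzmann κ t (t k)) := by
    simp only [AttentionHead.att, diagHead, rectId_mul_firstRow hV, rectId_mul_firstRow hK,
      rectId_mulVec_single hQ, hscore]
    ext i
    by_cases hi : i = 0
    · subst hi
      simp [Matrix.mulVec, dotProduct, firstRow, softmax, boltzmann, Finset.sum_div, mul_div_assoc]
    · simp [Matrix.mulVec, dotProduct, firstRow, hi]
  simp only [AttentionHead.eval, Matrix.of_apply, hcol, hatt]
  simp only [diagHead, rectId_mulVec_single hO]
  by_cases hi : i = 0
  · subst hi
    simp [firstRow]
  · simp [firstRow, hi]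

/-! ### Separation of contexts by the softmax average -/

open Polynomial in
-- Comparing leading coefficients in `R' * Q = Q' * R` gives `deg R = deg Q` for any nonzero
-- solution `R`. If `P ≠ Q`, then `P - Q` is also a solution, but cancellation of the leading terms
-- makes its degree too small.
lemma eq_of_derivative_mul_eq {P Q : ℤ[X]} (hP : P.Monic) (hQ : Q.Monic)
    (h : derivative P * Q = derivative Q * P) : P = Q := by
  have key : ∀ R : ℤ[X], R ≠ 0 → derivative R * Q = derivative Q * R →
      R.natDegree = Q.natDegree := by
    intro R hR hRQ
    have := congrArg leadingCoeff hRQ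
    simp only [leadingCoeff_mul, leadingCoeff_derivative, hQ.leadingCoeff, mul_one, one_mul] at this
    rw [mul_comm] at this
    exact_mod_cast mul_right_cancel₀ (leadingCoeff_ne_zero.mpr hR) this
  have hdeg := key P hP.ne_zero h
  by_contra hne
  have hD : P - Q ≠ 0 := sub_ne_zero.mpr hne
  have h1 := key (P - Q) hD (by rw [derivative_sub]; linear_combination h)
  have h2 : (P - Q).degree < P.degree := by
    refine degree_sub_lt_left ?_ hP.ne_zero (by rw [hP.leadingCoeff, hQ.leadingCoeff])
    rw [degree_eq_natDegree hP.ne_zero, degree_eq_natDegree hQ.ne_zero, hdeg]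
  have h3 := natDegree_lt_natDegree hD h2
  omega

open Polynomial in
lemma coeff_sum_X_pow {a : Fin L → ℕ} (ha : Function.Injective a) (n : ℕ)
    [Decidable (n ∈ Set.range a)] :
    (∑ j, (X : ℤ[X]) ^ a j).coeff n = if n ∈ Set.range a then 1 else 0 := by
  rw [finsetSum_coeff]
  simp only [coeff_X_pow]
  split_ifs with h
  · obtain ⟨j, rfl⟩ := h
    simp [ha.eq_iff]
  · refine Finset.sum_eq_zero fun j _ => if_neg ?_
    rintro rfl
    exact h ⟨j, rfl⟩

open Polynomial in
lemma monic_sum_X_pow [NeZero L] {a : Fin L → ℕ} (ha : Function.Injective a) :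
    (∑ j, (X : ℤ[X]) ^ a j).Monic := by
  classical
  have hne : (∑ j, (X : ℤ[X]) ^ a j) ≠ 0 := by
    intro h
    have := coeff_sum_X_pow ha (a 0)
    simp [h] at this
  have h1 := leadingCoeff_ne_zero.mpr hne
  rw [Monic]
  rw [leadingCoeff, coeff_sum_X_pow ha] at h1 ⊢
  split_ifs at h1 ⊢ with h
  · rfl
  · exact absurd rfl h1

/-- At `w = exp κ ^ x` both averages are `w` times a logarithmic derivative of an integer
polynomial. Transcendence of `w` lifts the equality to `ℤ[X]`, and the exponents occurring in the
polynomial are the labels. -/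
lemma range_eq_of_boltzmann_eq [NeZero L] {a b : Fin L → ℕ} (ha : Function.Injective a)
    (hb : Function.Injective b) {κ : ℝ} (hκ : Transcendental ℤ (Real.exp κ)) {x : ℕ} (hx : 0 < x)
    (h : boltzmann κ (fun j => a j) x = boltzmann κ (fun j => b j) x) :
    Set.range a = Set.range b := by
  classical
  have hw : Transcendental ℤ (Real.exp κ ^ x) := hκ.pow hx
  set w := Real.exp κ ^ x with hwdef
  have hw0 : 0 < w := by positivity
  have hexp : ∀ n : ℕ, Real.exp (κ * n * x) = w ^ n := by
    intro n
    rw [hwdef, ← pow_mul, ← Real.exp_nat_mul]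
    congr 1
    push_cast
    ring
  have hden : ∀ c : Fin L → ℕ, (∑ j, w ^ c j) ≠ 0 := fun c =>
    (Finset.sum_pos (fun j _ => pow_pos hw0 _) Finset.univ_nonempty).ne'
  -- Taking out `w` leaves the derivative evaluated at `w`. The truncated exponent at `c j = 0` does
  -- not matter, as its coefficient vanishes.
  have hmul : ∀ (c : Fin L → ℕ), ∑ j, (c j : ℝ) * w ^ c j = w * ∑ j, (c j : ℝ) * w ^ (c j - 1) := by
    intro c
    rw [Finset.mul_sum]
    refine Finset.sum_congr rfl fun j _ => ?_
    rcases Nat.eq_zero_or_pos (c j) with h0 | h0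
    · simp [h0]
    · obtain ⟨m, hm⟩ := Nat.exists_eq_succ_of_ne_zero h0.ne'
      rw [hm]
      simp only [Nat.succ_eq_add_one, Nat.add_sub_cancel]
      ring
  simp only [boltzmann, hexp] at h
  rw [div_eq_div_iff (hden a) (hden b), hmul, hmul, mul_assoc, mul_assoc] at h
  have h' := mul_left_cancel₀ hw0.ne' h
  have hPQ : (∑ j, (Polynomial.X : Polynomial ℤ) ^ a j) = ∑ j, Polynomial.X ^ b j := by
    refine eq_of_derivative_mul_eq (monic_sum_X_pow ha) (monic_sum_X_pow hb) ?_
    rw [← sub_eq_zero]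
    refine (transcendental_iff.mp hw) _ ?_
    simp only [Polynomial.derivative_X_pow, map_sub, map_mul, map_sum,
      map_pow, Polynomial.aeval_X, Polynomial.aeval_C]
    simpa [sub_eq_zero] using h'
  ext n
  have := congrArg (fun p => p.coeff n) hPQ
  simp only [coeff_sum_X_pow ha, coeff_sum_X_pow hb] at this
  by_cases h1 : n ∈ Set.range a <;> by_cases h2 : n ∈ Set.range b <;> simp_all

/-- The logarithm of the square of a Liouville number works; squaring makes positivity immediate. -/
lemma exists_transcendental_exp : ∃ κ : ℝ, κ ≠ 0 ∧ Transcendental ℤ (Real.exp κ) := by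
  have h := (transcendental_liouvilleNumber (m := 2) le_rfl).pow (n := 2) two_pos
  set x := liouvilleNumber ((2 : ℕ) : ℝ)
  have h0 : 0 < x ^ 2 := by
    refine lt_of_le_of_ne (sq_nonneg x) fun h0 => h ?_
    rw [← h0]
    exact isAlgebraic_zero
  refine ⟨Real.log (x ^ 2), fun h1 => h ?_, by rwa [Real.exp_log h0]⟩
  rw [← Real.exp_log h0, h1, Real.exp_zero]
  exact isAlgebraic_one

/-- A generic `c` allows `A + c * B` to coincide only when both `A` and `B` do. Equal `A` gives the
same position and query, then equal `B` gives the same set of labels. Since a label determines its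
position, the set determines the context. -/
lemma exists_separating_attention [NeZero L] {Γ : Type*} [Finite Γ] (a : Γ → Fin L → ℕ)
    (hpos : ∀ γ j, 0 < a γ j) (hk : ∀ γ γ' j j', a γ j = a γ' j' → j = j')
    (hinj : Function.Injective a) :
    ∃ κ c : ℝ, κ ≠ 0 ∧ 0 < c ∧ Function.Injective fun p : Fin L × Γ =>
      (a p.2 p.1 : ℝ) + c * boltzmann κ (fun j => a p.2 j) (a p.2 p.1) := by
  obtain ⟨κ, hκ0, hκ⟩ := exists_transcendental_exp
  let A : Fin L × Γ → ℝ := fun p => a p.2 p.1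
  let B : Fin L × Γ → ℝ := fun p => boltzmann κ (fun j => a p.2 j) (a p.2 p.1)
  -- For a pair with different `B`, exactly one `c` produces a collision; these finitely many values
  -- are avoided.
  have hfin : (Set.range fun q : (Fin L × Γ) × (Fin L × Γ) =>
      -(A q.1 - A q.2) / (B q.1 - B q.2)).Finite := Set.finite_range _
  obtain ⟨c, hc0, hc⟩ := (Set.Ioi_infinite (0 : ℝ)).exists_notMem_finset hfin.toFinset
  refine ⟨κ, c, hκ0, hc0, fun p p' hpp => ?_⟩
  replace hpp : A p + c * B p = A p' + c * B p' := hpp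
  have hB : B p = B p' := by
    by_contra hB
    refine hc (hfin.mem_toFinset.mpr ⟨(p, p'), ?_⟩)
    have : B p - B p' ≠ 0 := sub_ne_zero.mpr hB
    simp only
    rw [div_eq_iff this]
    linarith
  have hA : a p.2 p.1 = a p'.2 p'.1 := by
    rw [hB] at hpp
    have : A p = A p' := add_right_cancel hpp
    exact Nat.cast_injective this
  have h1 : p.1 = p'.1 := hk _ _ _ _ hA
  have hinj' : ∀ γ, Function.Injective (a γ) := fun γ j j' h => hk _ _ _ _ h
  have hr : Set.range (a p.2) = Set.range (a p'.2) := by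
    refine range_eq_of_boltzmann_eq (hinj' _) (hinj' _) hκ (hpos p.2 p.1) ?_
    have : B p = B p' := hB
    simp only [B, ← hA] at this
    exact this
  have h2 : p.2 = p'.2 := by
    refine hinj (funext fun j => ?_)
    obtain ⟨j', hj'⟩ := hr ▸ Set.mem_range_self (f := a p.2) j
    rw [← hj', hk _ _ _ _ hj']
  exact Prod.ext h1 h2

lemma boltzmann_mem_Icc [NeZero L] {t : Fin L → ℝ} {T : ℝ} (ht : ∀ j, t j ∈ Set.Icc 0 T) (κ x : ℝ) :
    boltzmann κ t x ∈ Set.Icc 0 T := by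
  have hden : 0 < ∑ j, Real.exp (κ * t j * x) :=
    Finset.sum_pos (fun j _ => Real.exp_pos _) Finset.univ_nonempty
  refine ⟨div_nonneg (Finset.sum_nonneg fun j _ => mul_nonneg (ht j).1 (Real.exp_pos _).le) hden.le,
    ?_⟩
  rw [boltzmann, div_le_iff₀ hden, Finset.mul_sum]
  exact Finset.sum_le_sum fun j _ => mul_le_mul_of_nonneg_right (ht j).2 (Real.exp_pos _).le

/-! ### Quantisation of the coordinates -/

/-- The breakpoints of `dent`. -/
def dentKnot (h η : ℝ) (m : ℕ) : Fin 3 → ℝ := ![m * h, (m + 1) * h - η, (m + 1) * h]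

/-- The slopes of `dent`. -/
def dentSlope (h η : ℝ) : Fin 3 → ℝ := ![-1, h / η, -(h / η - 1)]

/-- The piecewise linear function supported on `[m h, (m + 1) h]` for which `x + dent h η m x` is
constant on `[m h, (m + 1) h - η]`. -/
def dent (h η : ℝ) (m : ℕ) (x : ℝ) : ℝ :=
  ∑ l, dentSlope h η l * max (x - dentKnot h η m l) 0

section dent

variable {h η : ℝ} {m : ℕ} {x : ℝ}

lemma dent_eq : dent h η m x = -max (x - m * h) 0 + h / η * max (x - ((m + 1) * h - η)) 0 -
    (h / η - 1) * max (x - (m + 1) * h) 0 := by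
  simp [dent, dentSlope, dentKnot, Fin.sum_univ_three]
  ring

lemma dent_eq_zero_of_le (hη : 0 < η) (hh : η ≤ h) (hx : x ≤ m * h) : dent h η m x = 0 := by
  rw [dent_eq, max_eq_right (by linarith), max_eq_right (by linarith),
    max_eq_right (by linarith)]
  simp

lemma dent_eq_zero_of_ge (hη : 0 < η) (hh : η ≤ h) (hx : (m + 1) * h ≤ x) :
    dent h η m x = 0 := by
  rw [dent_eq, max_eq_left (by linarith), max_eq_left (by linarith),
    max_eq_left (by linarith)]
  field_simp
  ring

lemma dent_eq_sub (hη : 0 < η) (hx : m * h ≤ x) (hx' : x ≤ (m + 1) * h - η) :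
    dent h η m x = m * h - x := by
  rw [dent_eq, max_eq_left (by linarith), max_eq_right (by linarith),
    max_eq_right (by linarith)]
  ring

lemma dent_nonpos (hη : 0 < η) (hh : η ≤ h) : dent h η m x ≤ 0 := by
  rcases le_total x (m * h) with h1 | h1
  · exact (dent_eq_zero_of_le hη hh h1).le
  rcases le_total x ((m + 1) * h - η) with h2 | h2
  · rw [dent_eq_sub hη h1 h2]
    linarith
  rcases le_total ((m + 1) * h) x with h3 | h3
  · exact (dent_eq_zero_of_ge hη hh h3).le
  · rw [dent_eq, max_eq_left (by linarith), max_eq_left (by linarith), max_eq_right (by linarith)]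
    have : -(x - m * h) + h / η * (x - ((m + 1) * h - η)) - (h / η - 1) * 0 =
        (h / η - 1) * (x - (m + 1) * h) := by
      field_simp
      ring
    rw [this]
    refine mul_nonpos_of_nonneg_of_nonpos ?_ (by linarith)
    rw [sub_nonneg, le_div_iff₀ hη]
    linarith

lemma neg_max_le_dent (hη : 0 < η) (hh : η ≤ h) : -max (x - m * h) 0 ≤ dent h η m x := by
  rw [dent_eq]
  have h1 : 1 ≤ h / η := by rw [le_div_iff₀ hη]; linarith
  have h2 : max (x - (m + 1) * h) 0 ≤ max (x - ((m + 1) * h - η)) 0 :=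
    max_le_max (by linarith) le_rfl
  have h3 : 0 ≤ max (x - (m + 1) * h) 0 := le_max_right _ _
  nlinarith

end dent

/-- The sum of `x` and its first `n` dents: a staircase outside of bands of width `η`. -/
def staircase (h η : ℝ) (n : ℕ) (x : ℝ) : ℝ := x + ∑ m ∈ Finset.range n, dent h η m x

section staircase

variable {h η : ℝ}

lemma staircase_le (hη : 0 < η) (hh : η ≤ h) (n : ℕ) (x : ℝ) : staircase h η n x ≤ x := by
  have : ∑ m ∈ Finset.range n, dent h η m x ≤ 0 :=
    Finset.sum_nonpos fun m _ => dent_nonpos hη hh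
  rw [staircase]
  linarith

/-- Turns the sum of dents into a composition, as successive layers require. Left of `n * h` the new
dent vanishes at both arguments, because `staircase` never exceeds `x`. Right of it all earlier
dents vanish and `staircase` is still `x`. -/
lemma staircase_succ (hη : 0 < η) (hh : η ≤ h) (n : ℕ) (x : ℝ) :
    staircase h η (n + 1) x = staircase h η n x + dent h η n (staircase h η n x) := by
  rw [staircase, Finset.sum_range_succ, ← add_assoc]
  change staircase h η n x + _ = _
  congr 1
  rcases le_total x (n * h) with hx | hx
  · rw [dent_eq_zero_of_le hη hh hx,
      dent_eq_zero_of_le hη hh ((staircase_le hη hh n x).trans hx)]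
  · have : staircase h η n x = x := by
      rw [staircase, Finset.sum_eq_zero, add_zero]
      intro m hm
      refine dent_eq_zero_of_ge hη hh (le_trans ?_ hx)
      have : (m + 1 : ℝ) ≤ n := by exact_mod_cast Finset.mem_range.mp hm
      exact mul_le_mul_of_nonneg_right this (hη.le.trans hh)
    rw [this]

/-- Needed because the collecting layers use ReLU as the identity. A dent lowers a value `y ≥ 0` by
at most `max (y - n * h) 0 ≤ y`. -/
lemma staircase_nonneg (hη : 0 < η) (hh : η ≤ h) (n : ℕ) {x : ℝ} (hx : 0 ≤ x) : 0 ≤ staircase h η n x := by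
  induction n with
  | zero => simpa [staircase] using hx
  | succ n ih =>
    rw [staircase_succ hη hh]
    have h1 := neg_max_le_dent (m := n) (x := staircase h η n x) hη hh
    have h2 : max (staircase h η n x - n * h) 0 ≤ staircase h η n x :=
      max_le (by have : 0 ≤ n * h := by have := hη.le.trans hh; positivity
                 linarith) ih
    linarith

lemma staircase_eq (hη : 0 < η) (hh : η ≤ h) {n m : ℕ} (hm : m < n)
    {x : ℝ} (hx : m * h ≤ x)
    (hx' : x ≤ (m + 1) * h - η) :
    staircase h η n x = m * h := by
  have h0 : 0 ≤ h := hη.le.trans hh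
  rw [staircase, Finset.sum_eq_single m, dent_eq_sub hη hx hx']
  · ring
  · intro k _ hk
    rcases lt_or_gt_of_ne hk with hk | hk
    · refine dent_eq_zero_of_ge hη hh (le_trans ?_ hx)
      have : (k + 1 : ℝ) ≤ m := by exact_mod_cast hk
      exact mul_le_mul_of_nonneg_right this h0
    · refine dent_eq_zero_of_le hη hh (le_trans (hx'.trans (sub_le_self _ hη.le)) ?_)
      have : (m + 1 : ℝ) ≤ k := by exact_mod_cast hk
      exact mul_le_mul_of_nonneg_right this h0
  · intro h
    exact absurd (Finset.mem_range.mpr hm) h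

end staircase

/-! ### The first feed-forward part -/

lemma actLayers_append {r : ℕ} (l l' : List (FeedForward d r)) (z : Fin d → ℝ) :
    actLayers (l ++ l') z = actLayers l' (actLayers l z) := by
  simp [actLayers, List.foldl_append]

lemma actLayers_singleton {r : ℕ} (F : FeedForward d r) (z : Fin d → ℝ) :
    actLayers [F] z = F.act z := rfl

lemma exists_layers_staircase_coord {h η : ℝ} (hη : 0 < η) (hh : η ≤ h) (i : Fin d) (n : ℕ) :
    ∃ l : List (FeedForward d 4), l.length = n ∧
      ∀ z, actLayers l z = Function.update z i (staircase h η n (z i)) := by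
  induction n with
  | zero => exact ⟨[], rfl, fun z => by simp [actLayers, staircase]⟩
  | succ n ih =>
    obtain ⟨l, hl, hz⟩ := ih
    obtain ⟨F, hF⟩ := exists_feedForward (r := 4) (ι := Fin 3) (by simp) (fun _ => i)
      (dentKnot h η n) (fun l => dentSlope h η l • Pi.single i 1)
    refine ⟨l ++ [F], by simp [hl], fun z => ?_⟩
    rw [actLayers_append, hz, actLayers_singleton, hF, staircase_succ hη hh]
    ext j
    by_cases hj : j = i
    · subst hj
      simp [dent, mul_comm]
    · simp [hj]

lemma exists_layers_staircase {h η : ℝ} (hη : 0 < η) (hh : η ≤ h) (n : ℕ) :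
    ∃ l : List (FeedForward d 4), l.length = d * n ∧
      ∀ z, actLayers l z = fun i => staircase h η n (z i) := by
  suffices H : ∀ k ≤ d, ∃ l : List (FeedForward d 4), l.length = k * n ∧
      ∀ z, actLayers l z = fun i => if i.val < k then staircase h η n (z i) else z i by
    obtain ⟨l, hl, hz⟩ := H d le_rfl
    exact ⟨l, hl, fun z => by simp [hz]⟩
  intro k
  induction k with
  | zero => exact fun _ => ⟨[], by simp, fun z => by simp [actLayers]⟩
  | succ k ih =>
    intro hk
    obtain ⟨l, hl, hz⟩ := ih (by omega)
    obtain ⟨l', hl', hz'⟩ := exists_layers_staircase_coord hη hh (⟨k, hk⟩ : Fin d) n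
    refine ⟨l ++ l', by rw [List.length_append, hl, hl', Nat.succ_mul], fun z => ?_⟩
    rw [actLayers_append, hz', hz]
    ext j
    by_cases hj : j = ⟨k, hk⟩
    · subst hj
      simp
    · have : j.val ≠ k := fun h => hj (Fin.ext h)
      have h2 : j.val < k + 1 ↔ j.val < k := by omega
      simp [hj, h2]

/-- The token with first coordinate `∑ i, q i * z i` and the other coordinates zero. -/
def collect [NeZero d] (q z : Fin d → ℝ) : Fin d → ℝ := Pi.single 0 (∑ i, q i * z i)

lemma add_sum_smul_eq_collect [NeZero d] (q z : Fin d → ℝ) :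
    z + ∑ i, z i • (Pi.single 0 (q i) - Pi.single i 1 : Fin d → ℝ) = collect q z := by
  ext j
  simp only [Pi.add_apply, Finset.sum_apply, Pi.smul_apply, Pi.sub_apply, smul_eq_mul, mul_sub,
    Finset.sum_sub_distrib, collect]
  have : ∑ i, z i * (Pi.single i 1 : Fin d → ℝ) j = z j := by
    simp [Pi.single_apply]
  rw [this]
  by_cases hj : j = 0
  · subst hj
    simp [mul_comm]
  · simp [hj]

/-- On nonnegative tokens one ReLU reads a coordinate exactly, so each layer moves one coordinate
into the first, with its weight. -/
lemma exists_layers_collect [NeZero d] (q : Fin d → ℝ) :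
    ∃ l : List (FeedForward d 4), l.length = d ∧
      ∀ z, (∀ i, 0 ≤ z i) → actLayers l z = collect q z := by
  suffices H : ∀ k ≤ d, ∃ l : List (FeedForward d 4), l.length = k ∧ ∀ z, (∀ i, 0 ≤ z i) →
      actLayers l z = z + ∑ i with i.val < k,
        z i • (Pi.single 0 (q i) - Pi.single i 1 : Fin d → ℝ) by
    obtain ⟨l, hl, hz⟩ := H d le_rfl
    refine ⟨l, hl, fun z h0 => ?_⟩
    rw [hz z h0, ← add_sum_smul_eq_collect]
    simp
  intro k
  induction k with
  | zero => exact fun _ => ⟨[], rfl, fun z _ => by simp [actLayers]⟩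
  | succ k ih =>
    intro hk
    obtain ⟨l, hl, hz⟩ := ih (by omega)
    let κ : Fin d := ⟨k, hk⟩
    obtain ⟨F, hF⟩ := exists_feedForward (r := 4) (ι := Fin 1) (by simp) (fun _ => κ)
      (fun _ => 0) (fun _ => Pi.single 0 (q κ) - Pi.single κ 1)
    refine ⟨l ++ [F], by simp [hl], fun z h0 => ?_⟩
    have hset : (Finset.univ.filter fun i : Fin d => i.val < k + 1) =
        insert κ (Finset.univ.filter fun i : Fin d => i.val < k) := by
      ext i
      simp only [Finset.mem_filter, Finset.mem_univ, true_and, Finset.mem_insert, Fin.ext_iff, κ]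
      omega
    -- Coordinate `κ` is untouched until its turn. Coordinate `0`, which accumulates the sum, is
    -- itself read first.
    have hcoord : (z + ∑ i with i.val < k,
        z i • (Pi.single 0 (q i) - Pi.single i 1 : Fin d → ℝ)) κ = z κ := by
      rw [Pi.add_apply, Finset.sum_apply, Finset.sum_eq_zero, add_zero]
      intro i hi
      have hi : i.val < k := by simpa using hi
      have h1 : κ ≠ i := fun h => by simp [← h, κ] at hi
      have h2 : κ ≠ 0 := fun h => by
        have : k = 0 := congrArg Fin.val h
        omega
      simp [h1, h2]
    rw [actLayers_append, hz z h0, actLayers_singleton, hF, hset, Finset.sum_insert (by simp [κ])]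
    simp only [Finset.univ_unique, Finset.sum_const, Finset.card_singleton, one_smul, hcoord,
      sub_zero, max_eq_left (h0 κ)]
    rw [add_assoc, add_comm (∑ i with _, _)]

/-- The deep form of the first feed-forward part. -/
lemma exists_layers_encode [NeZero d] {h η : ℝ} (hη : 0 < η) (hh : η ≤ h) (n : ℕ) (q : Fin d → ℝ) :
    ∃ l : List (FeedForward d 4), l.length = d * n + d ∧
      ∀ z, (∀ i, 0 ≤ z i) → actLayers l z = collect q fun i => staircase h η n (z i) := by
  obtain ⟨l, hl, hz⟩ := exists_layers_staircase (d := d) hη hh n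
  obtain ⟨l', hl', hz'⟩ := exists_layers_collect q
  refine ⟨l ++ l', by simp [hl, hl'], fun z h0 => ?_⟩
  rw [actLayers_append, hz, hz' _ fun i => staircase_nonneg hη hh n (h0 i)]

/-- The shallow form of the first feed-forward part. -/
lemma exists_feedForward_encode [NeZero d] {r : ℕ} (h η : ℝ) (n : ℕ) (q : Fin d → ℝ)
    (hr : d + 3 * (d * n) ≤ r) :
    ∃ F : FeedForward d r, ∀ z, (∀ i, 0 ≤ z i) →
      F.act z = collect q fun i => staircase h η n (z i) := by
  obtain ⟨F, hF⟩ := exists_feedForward (r := r) (ι := Fin d ⊕ (Fin d × Fin n × Fin 3))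
    (by simp; linarith)
    (Sum.elim id fun p => p.1) (Sum.elim (fun _ => 0) fun p => dentKnot h η p.2.1 p.2.2)
    (Sum.elim (fun i => Pi.single 0 (q i) - Pi.single i 1)
      fun p => Pi.single 0 (q p.1 * dentSlope h η p.2.2))
  refine ⟨F, fun z h0 => ?_⟩
  rw [hF, Fintype.sum_sum_type, ← add_assoc]
  simp only [Sum.elim_inl, Sum.elim_inr, id, sub_zero, max_eq_left (h0 _)]
  rw [add_sum_smul_eq_collect]
  ext j
  by_cases hj : j = 0
  · subst hj
    simp only [collect, Pi.add_apply, Pi.single_eq_same, Finset.sum_apply, Pi.smul_apply,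
      smul_eq_mul, Fintype.sum_prod_type, staircase, mul_add, Finset.sum_add_distrib,
      Finset.sum_range, dent, Finset.mul_sum]
    congr 1
    refine Finset.sum_congr rfl fun i _ => Finset.sum_congr rfl fun m _ =>
      Finset.sum_congr rfl fun l _ => ?_
    ring
  · simp [collect, hj]

/-! ### The second feed-forward part -/

/-- The knots of `tent`. -/
def tentKnot (ρ y : ℝ) : Fin 3 → ℝ := ![y - ρ, y, y + ρ]

/-- The slopes of `tent`. -/
def tentSlope (ρ : ℝ) : Fin 3 → ℝ := ![1 / ρ, -(2 / ρ), 1 / ρ]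

/-- The tent of height `1` and radius `ρ` at `y`. -/
def tent (ρ y x : ℝ) : ℝ := ∑ l, tentSlope ρ l * max (x - tentKnot ρ y l) 0

lemma tent_eq (ρ y x : ℝ) : tent ρ y x = 1 / ρ * max (x - (y - ρ)) 0 - 2 / ρ * max (x - y) 0 +
    1 / ρ * max (x - (y + ρ)) 0 := by
  simp [tent, tentSlope, tentKnot, Fin.sum_univ_three]
  ring

lemma tent_self {ρ : ℝ} (hρ : 0 < ρ) (y : ℝ) : tent ρ y y = 1 := by
  rw [tent_eq, max_eq_left (by linarith), max_eq_left (by linarith), max_eq_right (by linarith)]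
  field_simp
  ring

lemma tent_eq_zero {ρ y x : ℝ} (hρ : 0 < ρ) (hx : ρ ≤ |x - y|) : tent ρ y x = 0 := by
  rw [tent_eq]
  rcases le_abs.mp hx with h | h
  · rw [max_eq_left (by linarith), max_eq_left (by linarith), max_eq_left (by linarith)]
    ring
  · rw [max_eq_right (by linarith), max_eq_right (by linarith), max_eq_right (by linarith)]
    ring

/-- With this radius the tent at one node vanishes at all others. The bound `ρ ≤ 1` serves the deep
form, where nodes are at least `2` and outputs at most `1`. -/
lemma exists_separation_radius {ι : Type*} [Finite ι] {y : ι → ℝ} (hy : Function.Injective y) :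
    ∃ ρ, 0 < ρ ∧ ρ ≤ 1 ∧ ∀ m n, m ≠ n → ρ ≤ |y m - y n| := by
  have h1 : ∀ᶠ ρ in 𝓝[>] (0 : ℝ), ∀ p : ι × ι, p.1 ≠ p.2 → ρ ≤ |y p.1 - y p.2| := by
    rw [eventually_all]
    intro p
    by_cases hp : p.1 = p.2
    · simp [hp]
    · have : 0 < |y p.1 - y p.2| := abs_pos.mpr (sub_ne_zero.mpr fun h => hp (hy h))
      filter_upwards [Ioc_mem_nhdsGT this] with ρ hρ _ using hρ.2
  obtain ⟨ρ, h, hρ⟩ := (h1.and (Ioc_mem_nhdsGT (zero_lt_one' ℝ))).exists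
  exact ⟨ρ, hρ.1, hρ.2, fun m n => h (m, n)⟩

/-- The shallow form of the second feed-forward part. -/
lemma exists_feedForward_interpolate [NeZero d] {ι : Type*} [Fintype ι] {r : ℕ}
    (hr : 3 * Fintype.card ι ≤ r) {y : ι → ℝ} (hy : Function.Injective y) (v : ι → Fin d → ℝ) :
    ∃ F : FeedForward d r, ∀ n, F.act (Pi.single 0 (y n)) = v n := by
  obtain ⟨ρ, hρ, -, hsep⟩ := exists_separation_radius hy
  obtain ⟨F, hF⟩ := exists_feedForward (d := d) (r := r) (ι := ι × Fin 3)
    (by simpa [mul_comm] using hr) (fun _ => 0) (fun p => tentKnot ρ (y p.1) p.2)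
    (fun p => tentSlope ρ p.2 • (v p.1 - Pi.single 0 (y p.1)))
  refine ⟨F, fun n => ?_⟩
  have : ∑ p : ι × Fin 3, max ((Pi.single 0 (y n) : Fin d → ℝ) 0 - tentKnot ρ (y p.1) p.2) 0 •
      (tentSlope ρ p.2 • (v p.1 - Pi.single 0 (y p.1))) =
      ∑ m, tent ρ (y m) (y n) • (v m - Pi.single 0 (y m)) := by
    rw [Fintype.sum_prod_type]
    refine Finset.sum_congr rfl fun m _ => ?_
    rw [tent, Finset.sum_smul]
    refine Finset.sum_congr rfl fun l _ => ?_
    rw [smul_smul, mul_comm, Pi.single_eq_same]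
  rw [hF, this, Finset.sum_eq_single n]
  · rw [tent_self hρ]
    simp
  · intro m _ hm
    rw [tent_eq_zero hρ (hsep n m hm.symm), zero_smul]
  · simp

/-- The deep form of the second feed-forward part. -/
lemma exists_layers_interpolate [NeZero d] {ι : Type*} [Fintype ι] {y : ι → ℝ}
    (hy : Function.Injective y) (hy2 : ∀ n, 2 ≤ y n) (v : ι → Fin d → ℝ) (hv : ∀ n, v n 0 ≤ 1) :
    ∃ l : List (FeedForward d 4), l.length = Fintype.card ι ∧
      ∀ n, actLayers l (Pi.single 0 (y n)) = v n := by
  obtain ⟨ρ, hρ, hρ1, hsep⟩ := exists_separation_radius hy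
  have hF : ∀ n, ∃ F : FeedForward d 4, ∀ z, F.act z =
      z + tent ρ (y n) (z 0) • (v n - Pi.single 0 (y n)) := by
    intro n
    obtain ⟨F, hF⟩ := exists_feedForward (d := d) (r := 4) (ι := Fin 3)
      (by simp) (fun _ => 0) (tentKnot ρ (y n))
      (fun l => tentSlope ρ l • (v n - Pi.single 0 (y n)))
    refine ⟨F, fun z => ?_⟩
    rw [hF, tent, Finset.sum_smul]
    congr 1
    refine Finset.sum_congr rfl fun l _ => ?_
    rw [smul_smul, mul_comm]
  choose F hF using hF
  refine ⟨Finset.univ.toList.map F, by simp, fun n => ?_⟩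
  -- A token already sent to its value has first coordinate at most `1`, outside every tent, so
  -- later layers leave it alone.
  have hfix : ∀ (l : List ι) (z : Fin d → ℝ), z 0 ≤ 1 → actLayers (l.map F) z = z := by
    intro l z hz
    induction l with
    | nil => rfl
    | cons m l ih =>
      change actLayers (l.map F) ((F m).act z) = z
      rw [hF, tent_eq_zero hρ, zero_smul, add_zero, ih]
      rw [le_abs]
      right
      linarith [hy2 m]
  suffices H : ∀ l : List ι, n ∈ l → actLayers (l.map F) (Pi.single 0 (y n)) = v n from
    H _ (by simp)
  intro l
  induction l with
  | nil => simp
  | cons m l ih =>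
    intro hn
    change actLayers (l.map F) ((F m).act (Pi.single 0 (y n))) = v n
    rw [hF, Pi.single_eq_same]
    by_cases hmn : n = m
    · subst hmn
      rw [tent_self hρ, one_smul, add_sub_cancel]
      exact hfix l _ (hv n)
    · rw [tent_eq_zero hρ (hsep n m hmn), zero_smul, add_zero]
      exact ih ((List.mem_cons.mp hn).resolve_left hmn)

/-! ### The error in `d_α` -/

lemma alphaNorm_rpow {α : ℝ} (hα : 1 ≤ α) (Z : Matrix (Fin d) (Fin L) ℝ) :
    alphaNorm α Z ^ α = ∑ i, ∑ k, |Z i k| ^ α := by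
  have h0 : 0 ≤ ∑ i, ∑ k, |Z i k| ^ α := by positivity
  rw [alphaNorm, ← Real.rpow_mul h0, one_div_mul_cancel (by linarith), Real.rpow_one]

lemma alphaNorm_nonneg (α : ℝ) (Z : Matrix (Fin d) (Fin L) ℝ) : 0 ≤ alphaNorm α Z :=
  Real.rpow_nonneg (by positivity) _

lemma alphaNorm_rpow_le {α : ℝ} (hα : 1 ≤ α) {Z : Matrix (Fin d) (Fin L) ℝ} {R : ℝ}
    (h : ∀ i k, |Z i k| ≤ R) : alphaNorm α Z ^ α ≤ d * L * R ^ α := by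
  rw [alphaNorm_rpow hα]
  calc ∑ i, ∑ k, |Z i k| ^ α ≤ ∑ _i : Fin d, ∑ _k : Fin L, R ^ α :=
        Finset.sum_le_sum fun i _ => Finset.sum_le_sum fun k _ =>
          Real.rpow_le_rpow (abs_nonneg _) (h i k) (by linarith)
    _ = d * L * R ^ α := by simp [mul_assoc]

/-- `Z` lies in the grid cell `g` of side `1 / G`, off the upper bands of width `η`. -/
def InCell {G : ℕ} (η : ℝ) (g : Fin d → Fin L → Fin G) (Z : Matrix (Fin d) (Fin L) ℝ) : Prop :=
  ∀ i k, (g i k : ℝ) / G ≤ Z i k ∧ Z i k ≤ ((g i k : ℝ) + 1) / G - η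

/-- The union of the bands of width `η` below the grid points. -/
def bands (G : ℕ) (η : ℝ) : Set ℝ :=
  ⋃ g : Fin G, Set.Icc (((g : ℝ) + 1) / G - η) (((g : ℝ) + 1) / G)

lemma volume_bands_le (G : ℕ) (η : ℝ) : volume (bands G η) ≤ ENNReal.ofReal (G * η) := by
  refine (measure_iUnion_le _).trans ?_
  simp [Real.volume_Icc, ENNReal.ofReal_mul]

lemma exists_cell {G : ℕ} (hG : 0 < G) {η x : ℝ} (hx : x ∈ Set.Icc (0 : ℝ) 1)
    (hb : x ∉ bands G η) (hη : 0 ≤ η) :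
    ∃ g : Fin G, (g : ℝ) / G ≤ x ∧ x ≤ ((g : ℝ) + 1) / G - η := by
  have hG' : (0 : ℝ) < G := by exact_mod_cast hG
  simp only [bands, Set.mem_iUnion, not_exists, Set.mem_Icc, not_and_or, not_le] at hb
  -- The point `1` lies in the last band, so the floor below is a valid cell index.
  have hx1 : x < 1 := by
    refine lt_of_le_of_ne hx.2 fun h1 => ?_
    have h2 := hb ⟨G - 1, by omega⟩
    have h3 : (((G - 1 : ℕ) : ℝ) + 1) / G = 1 := by
      rw [Nat.cast_sub hG, Nat.cast_one, sub_add_cancel, div_self hG'.ne']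
    rw [h3] at h2
    rcases h2 with h2 | h2 <;> linarith
  have hxG : 0 ≤ x * G := mul_nonneg hx.1 hG'.le
  have hfl : ⌊x * G⌋₊ < G := by
    rw [Nat.floor_lt hxG]
    nlinarith
  have h1 := Nat.floor_le hxG
  have h2 := Nat.lt_floor_add_one (x * G)
  refine ⟨⟨⌊x * G⌋₊, hfl⟩, ?_, ?_⟩
  · rw [div_le_iff₀ hG']
    exact h1
  · rcases hb ⟨⌊x * G⌋₊, hfl⟩ with h3 | h3
    · exact h3.le
    · rw [div_lt_iff₀ hG'] at h3
      exact absurd h3 (not_lt.mpr h2.le)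

lemma of_mem_cube_eq_pi : {X : Fin d → Fin L → ℝ | Matrix.of X ∈ cube d L} =
    Set.univ.pi fun _ => Set.univ.pi fun _ => Set.Icc (0 : ℝ) 1 := by
  ext X
  simp only [cube, Set.mem_ofPred_eq, Set.mem_pi, Set.mem_univ, forall_true_left, Matrix.of_apply]

lemma measurableSet_of_mem_cube :
    MeasurableSet {X : Fin d → Fin L → ℝ | Matrix.of X ∈ cube d L} := by
  rw [of_mem_cube_eq_pi]
  exact MeasurableSet.univ_pi fun _ => MeasurableSet.univ_pi fun _ => measurableSet_Icc

/-- The feed-forward encoders agree with `encode` only on nonnegative tokens, hence the restriction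
to the cube. -/
lemma dAlpha_congr {α : ℝ} {F F' f : Matrix (Fin d) (Fin L) ℝ → Matrix (Fin d) (Fin L) ℝ}
    (h : ∀ Z ∈ cube d L, F Z = F' Z) : dAlpha α F f = dAlpha α F' f := by
  rw [dAlpha, dAlpha, setLIntegral_congr_fun measurableSet_of_mem_cube]
  intro X hX
  simp only [h (Matrix.of X) hX]

lemma measurableSet_bad (i : Fin d) (k : Fin L) (G : ℕ) (η : ℝ) :
    MeasurableSet {X : Fin d → Fin L → ℝ | X i k ∈ bands G η} := by
  refine MeasurableSet.preimage (MeasurableSet.iUnion fun _ => measurableSet_Icc) ?_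
  fun_prop

lemma volume_bad_le (i : Fin d) (k : Fin L) (G : ℕ) (η : ℝ) :
    volume ({X : Fin d → Fin L → ℝ | X i k ∈ bands G η} ∩ {X | Matrix.of X ∈ cube d L}) ≤
      ENNReal.ofReal (G * η) := by
  have hsub : ({X : Fin d → Fin L → ℝ | X i k ∈ bands G η} ∩ {X | Matrix.of X ∈ cube d L}) ⊆
      Set.univ.pi fun i' => Set.univ.pi fun k' =>
        if i' = i ∧ k' = k then bands G η else Set.Icc (0 : ℝ) 1 := by
    rintro X ⟨hX, hX'⟩ i' - k' -
    simp only
    split_ifs with h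
    · rw [h.1, h.2]
      exact hX
    · exact hX' i' k'
  refine (measure_mono hsub).trans ?_
  rw [volume_pi_pi]
  simp only [volume_pi_pi]
  rw [Finset.prod_eq_single i, Finset.prod_eq_single k]
  · simpa using volume_bands_le G η
  · intro k' _ hk
    simp [hk]
  · simp
  · intro i' _ hi
    simp [hi]
  · simp

lemma dAlpha_le_of_cells {α : ℝ} (hα : 1 ≤ α) {G : ℕ} (hG : 0 < G) {η A R ε : ℝ} (hη : 0 ≤ η)
    (hA : 0 ≤ A) (hR : 0 ≤ R) (hε : 0 ≤ ε)
    {F f : Matrix (Fin d) (Fin L) ℝ → Matrix (Fin d) (Fin L) ℝ}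
    (hgood : ∀ Z ∈ cube d L, ∀ g : Fin d → Fin L → Fin G, InCell η g Z →
      alphaNorm α (F Z - f Z) ^ α ≤ A)
    (hbad : ∀ Z ∈ cube d L, alphaNorm α (F Z - f Z) ^ α ≤ R)
    (hsum : A + R * (d * L * (G * η)) ≤ ε ^ α) :
    dAlpha α F f ≤ ENNReal.ofReal ε := by
  have hα0 : 0 < α := by linarith
  set S : Set (Fin d → Fin L → ℝ) := {X | Matrix.of X ∈ cube d L} with hS
  have hSm : MeasurableSet S := measurableSet_of_mem_cube
  have hSv : volume S = 1 := by
    rw [hS, of_mem_cube_eq_pi, volume_pi_pi]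
    simp only [volume_pi_pi, Real.volume_Icc]
    simp
  let B : Set (Fin d → Fin L → ℝ) := ⋃ i, ⋃ k, {X | X i k ∈ bands G η}
  have hBm : MeasurableSet B :=
    MeasurableSet.iUnion fun i => MeasurableSet.iUnion fun k => measurableSet_bad i k G η
  have hBv : volume (B ∩ S) ≤ ENNReal.ofReal (d * L * (G * η)) := by
    simp only [B, Set.iUnion_inter]
    refine (measure_iUnion_le _).trans ?_
    rw [tsum_fintype]
    calc ∑ i, volume (⋃ k, {X : Fin d → Fin L → ℝ | X i k ∈ bands G η} ∩ S)
        ≤ ∑ _i : Fin d, ∑ _k : Fin L, ENNReal.ofReal (G * η) := by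
          refine Finset.sum_le_sum fun i _ => (measure_iUnion_le _).trans ?_
          rw [tsum_fintype]
          exact Finset.sum_le_sum fun k _ => volume_bad_le i k G η
      _ = ENNReal.ofReal (d * L * (G * η)) := by
          rw [ENNReal.ofReal_mul (by positivity), ENNReal.ofReal_mul (by positivity)]
          simp [mul_assoc]
  have hint : (∫⁻ X in S, ENNReal.ofReal (alphaNorm α (F (Matrix.of X) - f (Matrix.of X)) ^ α)) ≤
      ENNReal.ofReal (ε ^ α) := by
    calc (∫⁻ X in S, ENNReal.ofReal (alphaNorm α (F (Matrix.of X) - f (Matrix.of X)) ^ α))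
        -- The majorant is measurable, so measurability of `F` and `f` is never needed.
        ≤ ∫⁻ X in S, (ENNReal.ofReal A + B.indicator (fun _ => ENNReal.ofReal R) X) := by
          refine setLIntegral_mono' hSm fun X hX => ?_
          by_cases hXB : X ∈ B
          · rw [Set.indicator_of_mem hXB]
            exact (ENNReal.ofReal_le_ofReal (hbad _ hX)).trans le_add_self
          · have hc : ∀ i k, ∃ g : Fin G, (g : ℝ) / G ≤ X i k ∧ X i k ≤ ((g : ℝ) + 1) / G - η :=
              fun i k => exists_cell hG (hX i k)
                (fun h => hXB (Set.mem_iUnion₂.mpr ⟨i, k, h⟩)) hη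
            choose g hg using hc
            exact (ENNReal.ofReal_le_ofReal (hgood _ hX g hg)).trans le_self_add
      _ = ENNReal.ofReal A * volume S + ENNReal.ofReal R * volume (B ∩ S) := by
          rw [lintegral_add_left measurable_const, setLIntegral_const,
            lintegral_indicator_const hBm, Measure.restrict_apply hBm]
      _ ≤ ENNReal.ofReal A + ENNReal.ofReal R * ENNReal.ofReal (d * L * (G * η)) := by
          rw [hSv, mul_one]
          gcongr
      _ = ENNReal.ofReal (A + R * (d * L * (G * η))) := by
          rw [← ENNReal.ofReal_mul hR, ← ENNReal.ofReal_add hA (by positivity)]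
      _ ≤ ENNReal.ofReal (ε ^ α) := ENNReal.ofReal_le_ofReal hsum
  calc dAlpha α F f ≤ ENNReal.ofReal (ε ^ α) ^ (1 / α) :=
        ENNReal.rpow_le_rpow hint (by positivity)
    _ = ENNReal.ofReal ε := by
        rw [ENNReal.ofReal_rpow_of_nonneg (by positivity) (by positivity), ← Real.rpow_mul hε,
          mul_one_div_cancel hα0.ne', Real.rpow_one]

/-! ### Integer labels of quantised tokens -/

/-- The index of the cell of the `i`-th coordinate of the `k`-th token, shifted by its position. -/
def digit {G : ℕ} (g : Fin d → Fin L → Fin G) (i : Fin d) (k : Fin L) : ℕ :=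
  (k + 3) * G + g i k

/-- The label of the `k`-th token. -/
def label {G : ℕ} (g : Fin d → Fin L → Fin G) (k : Fin L) : ℕ :=
  ∑ i, digit g i k * ((L + 3) * G) ^ (i : ℕ)

section label

variable {G : ℕ} {g g' : Fin d → Fin L → Fin G} {k k' : Fin L}

lemma digit_lt (g : Fin d → Fin L → Fin G) (i : Fin d) (k : Fin L) :
    digit g i k < (L + 3) * G := by
  calc digit g i k < (k + 3) * G + G := Nat.add_lt_add_left (g i k).isLt _
    _ = (k + 1 + 3) * G := by ring
    _ ≤ (L + 3) * G := Nat.mul_le_mul_right _ (by have := k.isLt; omega)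

/-- Uniqueness of base `(L + 3) * G` expansions, in the form of the bijection `finFunctionFinEquiv`.
-/
lemma digit_eq_of_label_eq (h : label g k = label g' k') (i : Fin d) :
    digit g i k = digit g' i k' := by
  have h1 := finFunctionFinEquiv_apply fun i => (⟨digit g i k, digit_lt g i k⟩ : Fin ((L + 3) * G))
  have h2 := finFunctionFinEquiv_apply
    fun i => (⟨digit g' i k', digit_lt g' i k'⟩ : Fin ((L + 3) * G))
  have h3 := finFunctionFinEquiv.injective (Fin.ext (h1.trans (h.trans h2.symm)))
  exact congrArg Fin.val (congrFun h3 i)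

lemma digit_eq_iff {i : Fin d} : digit g i k = digit g' i k' ↔ k = k' ∧ g i k = g' i k' := by
  constructor
  · intro h
    have hG : 0 < G := (Nat.zero_le _).trans_lt (g i k).isLt
    have hd : ∀ (g : Fin d → Fin L → Fin G) k, digit g i k / G = k + 3 := fun g k => by
      rw [digit, mul_comm, Nat.mul_add_div hG, Nat.div_eq_of_lt (g i k).isLt, add_zero]
    have h1 := congrArg (· / G) h
    simp only [hd] at h1
    have h2 : k = k' := Fin.ext (by omega)
    subst h2
    exact ⟨rfl, Fin.ext (Nat.add_left_cancel h)⟩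
  · rintro ⟨rfl, h⟩
    rw [digit, digit, h]

lemma eq_of_label_eq [NeZero d] (h : label g k = label g' k') : k = k' :=
  (digit_eq_iff.mp (digit_eq_of_label_eq h 0)).1

lemma label_injective : Function.Injective fun g : Fin d → Fin L → Fin G => label g := by
  intro g g' h
  ext i k
  rw [(digit_eq_iff.mp (digit_eq_of_label_eq (congrFun h k) i)).2]

lemma three_le_label [NeZero d] (g : Fin d → Fin L → Fin G) (k : Fin L) : 3 ≤ label g k := by
  have hG : 0 < G := (Nat.zero_le _).trans_lt (g 0 k).isLt
  calc 3 ≤ digit g 0 k := by rw [digit]; nlinarith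
    _ = digit g 0 k * ((L + 3) * G) ^ ((0 : Fin d) : ℕ) := by simp
    _ ≤ label g k := Finset.single_le_sum
        (f := fun i : Fin d => digit g i k * ((L + 3) * G) ^ (i : ℕ)) (fun _ _ => Nat.zero_le _)
        (Finset.mem_univ _)

end label

/-- The positional embedding that shifts the `k`-th token by `k + 3`. -/
def shiftEmbedding (d L : ℕ) : Matrix (Fin d) (Fin L) ℝ := Matrix.of fun _ k => (k : ℝ) + 3

/-- The coefficients that turn quantised tokens into labels. -/
def labelCoeff (d L G : ℕ) (i : Fin d) : ℝ := G * (((L + 3) * G : ℕ) : ℝ) ^ (i : ℕ)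

/-- The map of tokens realised by the first feed-forward part. -/
def encode [NeZero d] (L G : ℕ) (η : ℝ) (z : Fin d → ℝ) : Fin d → ℝ :=
  collect (labelCoeff d L G) fun i => staircase (1 / G) η ((L + 3) * G) (z i)

/-- The first coordinate of the encoded `k`-th token. -/
def code (G : ℕ) (η : ℝ) (Z : Matrix (Fin d) (Fin L) ℝ) (k : Fin L) : ℝ :=
  ∑ i, labelCoeff d L G i * staircase (1 / G) η ((L + 3) * G) (Z i k + ((k : ℝ) + 3))

lemma mapCols_encode [NeZero d] (G : ℕ) (η : ℝ) (Z : Matrix (Fin d) (Fin L) ℝ) :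
    mapCols (encode L G η) (Z + shiftEmbedding d L) = firstRow (code G η Z) := rfl

lemma code_eq_label {G : ℕ} (hG : 0 < G) {η : ℝ} (hη : 0 < η) (hη' : η ≤ 1 / G)
    {g : Fin d → Fin L → Fin G} {Z : Matrix (Fin d) (Fin L) ℝ} (hZ : InCell η g Z) (k : Fin L) :
    code G η Z k = label g k := by
  have hG' : (0 : ℝ) < G := by exact_mod_cast hG
  rw [code, label, Nat.cast_sum]
  refine Finset.sum_congr rfl fun i _ => ?_
  obtain ⟨h1, h2⟩ := hZ i k
  have hd : (digit g i k : ℝ) * (1 / G) = (k : ℝ) + 3 + g i k / G := by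
    rw [digit]
    push_cast
    field_simp
  -- The `(L + 3) * G` steps of width `1 / G` cover `[0, L + 3]`, which contains every shifted
  -- token.
  rw [staircase_eq hη hη' (digit_lt g i k), labelCoeff]
  · push_cast
    field_simp
  · rw [hd]
    linarith
  · rw [add_mul, hd, one_mul]
    rw [add_div] at h2
    linarith

lemma code_mem_Icc {G : ℕ} (hG : 0 < G) {η : ℝ} (hη : 0 < η) (hη' : η ≤ 1 / G)
    {Z : Matrix (Fin d) (Fin L) ℝ} (hZ : Z ∈ cube d L) (k : Fin L) :
    code G η Z k ∈ Set.Icc 0 (∑ i, labelCoeff d L G i * (L + 4)) := by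
  have hq : ∀ i, 0 ≤ labelCoeff d L G i := fun i => by rw [labelCoeff]; positivity
  have hk : (k : ℝ) ≤ L := by exact_mod_cast k.isLt.le
  constructor
  · refine Finset.sum_nonneg fun i _ => mul_nonneg (hq i) (staircase_nonneg hη hη' _ ?_)
    have := (hZ i k).1
    positivity
  · refine Finset.sum_le_sum fun i _ => mul_le_mul_of_nonneg_left ?_ (hq i)
    refine (staircase_le hη hη' _ _).trans ?_
    linarith [(hZ i k).2]

/-! ### Approximation of Lipschitz maps -/

/-- The lower corner of the grid cell `g`. -/
def corner {G : ℕ} (g : Fin d → Fin L → Fin G) : Matrix (Fin d) (Fin L) ℝ :=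
  Matrix.of fun i k => (g i k : ℝ) / G

lemma corner_mem_cube {G : ℕ} (g : Fin d → Fin L → Fin G) : corner g ∈ cube d L := by
  intro i k
  have h : (g i k : ℝ) ≤ G := by exact_mod_cast (g i k).isLt.le
  exact ⟨by simp only [corner, Matrix.of_apply]; positivity, div_le_one_of_le₀ h (by positivity)⟩

lemma alphaNorm_corner_sub_le {α C ε : ℝ} (hα : 1 ≤ α) (hC : 0 ≤ C) (hε : 0 ≤ ε) {G : ℕ}
    (hG : 0 < G) (hdL : 1 ≤ d * L) (hGε : 2 * C * (d * L) ≤ ε * G)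
    {f : Matrix (Fin d) (Fin L) ℝ → Matrix (Fin d) (Fin L) ℝ} (hf : IsTarget α C f) {η : ℝ}
    (hη : 0 ≤ η) {g : Fin d → Fin L → Fin G} {Z : Matrix (Fin d) (Fin L) ℝ} (hZ : Z ∈ cube d L)
    (hg : InCell η g Z) : alphaNorm α (f (corner g) - f Z) ^ α ≤ ε ^ α / 2 := by
  have hα0 : 0 < α := by linarith
  have hG' : (0 : ℝ) < G := by exact_mod_cast hG
  have hn : (1 : ℝ) ≤ d * L := by exact_mod_cast hdL
  set n : ℝ := d * L
  have h1 : alphaNorm α (corner g - Z) ^ α ≤ n * (1 / G) ^ α := by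
    refine alphaNorm_rpow_le hα fun i k => ?_
    obtain ⟨h1, h2⟩ := hg i k
    rw [add_div] at h2
    simp only [corner, Matrix.sub_apply, Matrix.of_apply, abs_le]
    constructor <;> linarith [one_div_pos.mpr hG']
  calc alphaNorm α (f (corner g) - f Z) ^ α ≤ (C * alphaNorm α (corner g - Z)) ^ α :=
        Real.rpow_le_rpow (alphaNorm_nonneg _ _) (hf.2 _ (corner_mem_cube g) _ hZ) hα0.le
    _ = C ^ α * alphaNorm α (corner g - Z) ^ α := Real.mul_rpow hC (alphaNorm_nonneg _ _)
    _ ≤ C ^ α * (n * (1 / G) ^ α) := mul_le_mul_of_nonneg_left h1 (by positivity)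
    _ = n * (C / G) ^ α := by
        rw [div_eq_mul_one_div C, Real.mul_rpow hC (by positivity)]
        ring
    _ ≤ n * (ε / (2 * n)) ^ α := by
        refine mul_le_mul_of_nonneg_left (Real.rpow_le_rpow (by positivity) ?_ hα0.le)
          (by positivity)
        rw [div_le_div_iff₀ hG' (by positivity)]
        linarith
    _ = ε ^ α * (n / (2 * n) ^ α) := by
        rw [Real.div_rpow hε (by positivity)]
        ring
    _ ≤ ε ^ α * (1 / 2) := by
        refine mul_le_mul_of_nonneg_left ?_ (by positivity)
        -- As `2 * n ≥ 1` and `α ≥ 1`, the factor `n / (2 * n) ^ α` is at most `1 / 2`.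
        have h3 : 2 * n ≤ (2 * n) ^ α := Real.self_le_rpow_of_one_le (by linarith) hα
        rw [div_le_div_iff₀ (by positivity) two_pos]
        linarith
    _ = ε ^ α / 2 := by ring

/-- The attention head and the interpolation problem to which the approximation reduces. -/
lemma exists_head_and_nodes [NeZero d] [NeZero L] {α C ε : ℝ} (hα : 1 ≤ α) (hC : 0 ≤ C)
    (hε : 0 < ε) {G : ℕ} (hG : 0 < G) (hGε : 2 * C * (d * L) ≤ ε * G)
    {f : Matrix (Fin d) (Fin L) ℝ → Matrix (Fin d) (Fin L) ℝ} (hf : IsTarget α C f)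
    {s ρO ρV ρK ρQ : ℕ} (hO : ρO ∈ Set.Icc 1 (min d s)) (hV : ρV ∈ Set.Icc 1 (min d s))
    (hK : ρK ∈ Set.Icc 1 (min d s)) (hQ : ρQ ∈ Set.Icc 1 (min d s)) :
    ∃ (A : AttentionHead d s) (y : Fin L × (Fin d → Fin L → Fin G) → ℝ)
      (v : Fin L × (Fin d → Fin L → Fin G) → Fin d → ℝ),
      A.HasRanks ρO ρV ρK ρQ ∧ Function.Injective y ∧ (∀ p, 2 ≤ y p) ∧ (∀ p i, v p i ≤ 1) ∧
      ∀ P : (Fin d → ℝ) → Fin d → ℝ, Continuous P → (∀ p, P (Pi.single 0 (y p)) = v p) →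
        ∃ η : ℝ, 0 < η ∧ η ≤ 1 / G ∧
          dAlpha α (fun Z => mapCols P (A.eval (mapCols (encode L G η) (Z + shiftEmbedding d L)))) f
            ≤ ENNReal.ofReal ε := by
  have hs : NeZero s := ⟨by have := hO.1.trans (hO.2.trans (min_le_right _ _)); omega⟩
  have hG' : (0 : ℝ) < G := by exact_mod_cast hG
  have hdL : 1 ≤ d * L := Nat.mul_pos (NeZero.pos d) (NeZero.pos L)
  obtain ⟨κ, c, hκ, hc, hinj⟩ := exists_separating_attention
    (fun g : Fin d → Fin L → Fin G => label g)
    (fun g k => by have := three_le_label g k; omega) (fun _ _ _ _ h => eq_of_label_eq h)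
    label_injective
  refine ⟨diagHead d s ρO ρV ρK ρQ κ c, _, fun p i => f (corner p.2) i p.1,
    diagHead_hasRanks hκ hc.ne' hO.2 hV.2 hK.2 hQ.2, hinj, fun p => ?_,
    fun p i => (hf.1 (corner_mem_cube _) i p.1).2, fun P hP hPy => ?_⟩
  · have h3 : (3 : ℝ) ≤ label p.2 p.1 := by exact_mod_cast three_le_label p.2 p.1
    have h4 := (boltzmann_mem_Icc (t := fun j => (label p.2 j : ℝ))
      (T := ∑ j, (label p.2 j : ℝ)) (fun j => ⟨by positivity,
        Finset.single_le_sum (f := fun j => (label p.2 j : ℝ)) (fun _ _ => by positivity)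
          (Finset.mem_univ j)⟩) κ (label p.2 p.1)).1
    have := mul_nonneg hc.le h4
    linarith
  set T : ℝ := ∑ i, labelCoeff d L G i * (L + 4)
  -- For every admissible `η` the codes lie in `[0, T]`, so the attention output lies in `[0, T + c
  -- * T]`. Thus `R` bounds `P` independently of `η`, which can be chosen afterwards.
  obtain ⟨R, hR⟩ := (isCompact_Icc (a := (0 : ℝ)) (b := T + c * T)).exists_bound_of_continuousOn
    (f := fun x => P (Pi.single 0 x)) (hP.comp (continuous_single 0)).continuousOn
  set S : ℝ := d * L * (|R| + 1) ^ α
  have hS : 0 ≤ S := by positivity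
  have hε2 : 0 < ε ^ α / 2 := by positivity
  -- The bands contribute at most `S * (d * L * G) * η ≤ D * η`; the `1` only ensures `D > 0`.
  set D : ℝ := S * (d * L * G) + 1
  have hD : 0 < D := by positivity
  refine ⟨min (1 / G) (ε ^ α / 2 / D), by positivity, min_le_left _ _, ?_⟩
  set η : ℝ := min (1 / G) (ε ^ α / 2 / D)
  have hη : 0 < η := by positivity
  have hη' : η ≤ 1 / G := min_le_left _ _
  have hF : ∀ Z : Matrix (Fin d) (Fin L) ℝ, ∀ i k,
      mapCols P ((diagHead d s ρO ρV ρK ρQ κ c).eval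
        (mapCols (encode L G η) (Z + shiftEmbedding d L))) i k =
      P (Pi.single 0 (code G η Z k + c * boltzmann κ (code G η Z) (code G η Z k))) i := by
    intro Z i k
    rw [mapCols_encode, diagHead_eval_firstRow κ c hO.1 hV.1 hK.1 hQ.1]
    rfl
  refine dAlpha_le_of_cells hα hG hη.le hε2.le hS hε.le (fun Z hZ g hg => ?_) (fun Z hZ => ?_) ?_
  · have : mapCols P ((diagHead d s ρO ρV ρK ρQ κ c).eval
        (mapCols (encode L G η) (Z + shiftEmbedding d L))) = f (corner g) := by
      ext i k
      have hcode : code G η Z = fun k => (label g k : ℝ) :=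
        funext fun k => code_eq_label hG hη hη' hg k
      rw [hF, hcode]
      exact congrFun (hPy (k, g)) i
    simp only [this]
    exact alphaNorm_corner_sub_le hα hC hε.le hG hdL hGε hf hη.le hZ hg
  · refine alphaNorm_rpow_le hα fun i k => ?_
    rw [Matrix.sub_apply, hF]
    have hcode := code_mem_Icc hG hη hη' hZ
    have hb := boltzmann_mem_Icc hcode κ (code G η Z k)
    have h1 := hR (code G η Z k + c * boltzmann κ (code G η Z) (code G η Z k))
      ⟨add_nonneg (hcode k).1 (mul_nonneg hc.le hb.1),
        add_le_add (hcode k).2 (mul_le_mul_of_nonneg_left hb.2 hc.le)⟩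
    have h2 := (norm_le_pi_norm _ i).trans (h1.trans (le_abs_self R))
    rw [Real.norm_eq_abs] at h2
    have h3 := hf.1 hZ i k
    have h4 : |f Z i k| ≤ 1 := abs_le.mpr ⟨by linarith [h3.1], h3.2⟩
    exact (abs_sub _ _).trans (add_le_add h2 h4)
  · have h1 : η ≤ ε ^ α / 2 / D := min_le_right _ _
    rw [le_div_iff₀ hD] at h1
    have h2 : S * (d * L * (G * η)) ≤ η * D := by
      simp only [D]
      nlinarith
    linarith

lemma add_shiftEmbedding_nonneg {Z : Matrix (Fin d) (Fin L) ℝ} (hZ : Z ∈ cube d L) (k : Fin L)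
    (i : Fin d) : 0 ≤ (Z + shiftEmbedding d L).col k i := by
  have := (hZ i k).1
  simp only [Matrix.col, Matrix.transpose_apply, Matrix.add_apply, shiftEmbedding, Matrix.of_apply]
  positivity

lemma mapCols_congr {P Q : (Fin d → ℝ) → Fin d → ℝ} (h : ∀ z, (∀ i, 0 ≤ z i) → P z = Q z)
    {Z : Matrix (Fin d) (Fin L) ℝ} (hZ : ∀ k i, 0 ≤ Z.col k i) : mapCols P Z = mapCols Q Z := by
  ext i k
  exact congrFun (h _ (hZ k)) i

/-! ### Grid resolution and its growth rate -/

/-- The resolution of the grid. -/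
def gridSize (d L : ℕ) (C ε : ℝ) : ℕ := ⌈2 * C * (d * L) / ε⌉₊ + 1

lemma gridSize_pos (d L : ℕ) (C ε : ℝ) : 0 < gridSize d L C ε := Nat.succ_pos _

lemma le_mul_gridSize (d L : ℕ) (C : ℝ) {ε : ℝ} (hε : 0 < ε) :
    2 * C * (d * L) ≤ ε * gridSize d L C ε := by
  have h := Nat.le_ceil (2 * C * (d * L) / ε)
  rw [div_le_iff₀ hε] at h
  rw [gridSize, Nat.cast_add, Nat.cast_one]
  nlinarith

lemma isBigO_gridSize_pow (d L : ℕ) {C : ℝ} (hC : 0 ≤ C) (K n : ℕ) :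
    (fun ε : ℝ => ((K * gridSize d L C ε ^ n : ℕ) : ℝ)) =O[𝓝[>] 0] fun ε : ℝ => (1 / ε) ^ n := by
  refine IsBigO.of_bound (K * (2 * C * (d * L) + 2) ^ n) ?_
  filter_upwards [Ioc_mem_nhdsGT (zero_lt_one' ℝ)] with ε hε
  have hε0 := hε.1
  have h1 : (gridSize d L C ε : ℝ) ≤ (2 * C * (d * L) + 2) * (1 / ε) := by
    have h2 := (Nat.ceil_lt_add_one (a := 2 * C * (d * L) / ε) (by positivity)).le
    -- For `ε ≤ 1` the ceiling and the added `1` cost at most `2 ≤ 2 / ε`.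
    have h3 : 1 ≤ 1 / ε := by rw [le_div_iff₀ hε0]; linarith [hε.2]
    rw [gridSize, Nat.cast_add, Nat.cast_one, add_mul, mul_one_div]
    linarith
  rw [Real.norm_of_nonneg (by positivity), Real.norm_of_nonneg (by positivity), Nat.cast_mul,
    Nat.cast_pow, mul_assoc, ← mul_pow]
  gcongr

lemma card_nodes (d L G : ℕ) :
    Fintype.card (Fin L × (Fin d → Fin L → Fin G)) = L * G ^ (d * L) := by
  simp [← pow_mul, mul_comm L d]

end AnyRankAttention

end

/-! ### Assembly of the deep and the shallow transformer -/

open AnyRankAttention in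
theorem mainTheorem5 (d L : ℕ) (hd : 1 ≤ d) (hL : 1 ≤ L) (α : ℝ) (hα : 1 ≤ α)
    (C : ℝ) (hC : 0 ≤ C) :
    (∃ N : ℝ → ℕ,
      (fun ε : ℝ => (N ε : ℝ)) =O[𝓝[>] 0] (fun ε : ℝ => (1 / ε) ^ (d * L)) ∧
      ∀ ε : ℝ, 0 < ε →
      ∀ f : Matrix (Fin d) (Fin L) ℝ → Matrix (Fin d) (Fin L) ℝ,
      AnyRankAttention.IsTarget α C f →
      ∀ s ρO ρV ρK ρQ : ℕ,
      ρO ∈ Set.Icc 1 (min d s) → ρV ∈ Set.Icc 1 (min d s) →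
      ρK ∈ Set.Icc 1 (min d s) → ρQ ∈ Set.Icc 1 (min d s) →
      ∃ (τ : AnyRankAttention.TransformerA d s 4) (E : Matrix (Fin d) (Fin L) ℝ),
        τ.head.HasRanks ρO ρV ρK ρQ ∧
        τ.numFF ≤ N ε ∧
        AnyRankAttention.dAlpha α (fun Z => τ.eval (Z + E)) f ≤ ENNReal.ofReal ε) ∧
    (∃ r : ℝ → ℕ,
      (fun ε : ℝ => (r ε : ℝ)) =O[𝓝[>] 0] (fun ε : ℝ => (1 / ε) ^ (d * L)) ∧
      ∀ ε : ℝ, 0 < ε →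
      ∀ f : Matrix (Fin d) (Fin L) ℝ → Matrix (Fin d) (Fin L) ℝ,
      AnyRankAttention.IsTarget α C f →
      ∀ s ρO ρV ρK ρQ : ℕ,
      ρO ∈ Set.Icc 1 (min d s) → ρV ∈ Set.Icc 1 (min d s) →
      ρK ∈ Set.Icc 1 (min d s) → ρQ ∈ Set.Icc 1 (min d s) →
      ∃ (τ : AnyRankAttention.TransformerB d s (r ε)) (E : Matrix (Fin d) (Fin L) ℝ),
        τ.head.HasRanks ρO ρV ρK ρQ ∧
        AnyRankAttention.dAlpha α (fun Z => τ.eval (Z + E)) f ≤ ENNReal.ofReal ε) := by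
  have : NeZero d := ⟨by omega⟩
  have : NeZero L := ⟨by omega⟩
  have hG : ∀ ε, 0 < gridSize d L C ε := gridSize_pos d L C
  have hpow : ∀ ε, gridSize d L C ε ≤ gridSize d L C ε ^ (d * L) ∧
      1 ≤ gridSize d L C ε ^ (d * L) := fun ε =>
    ⟨Nat.le_self_pow (Nat.mul_pos hd hL).ne' _, Nat.one_le_pow _ _ (hG ε)⟩
  -- The three terms count layers for the staircases, the collection and the interpolation, using `G
  -- ≤ G ^ (d * L)` and `1 ≤ G ^ (d * L)`.
  refine ⟨⟨fun ε => (d * (L + 3) + d + L) * gridSize d L C ε ^ (d * L),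
    isBigO_gridSize_pow d L hC _ _, fun ε hε f hf s ρO ρV ρK ρQ hO hV hK hQ => ?_⟩,
    -- Both layers must have the same width, so this is the sum of the encoding and interpolation
    -- counts, with three neurons per dent or tent.
    ⟨fun ε => (d + 3 * (d * (L + 3)) + 3 * L) * gridSize d L C ε ^ (d * L),
    isBigO_gridSize_pow d L hC _ _, fun ε hε f hf s ρO ρV ρK ρQ hO hV hK hQ => ?_⟩⟩
  · obtain ⟨A, y, v, hA, hy, hy2, hv, H⟩ := exists_head_and_nodes hα hC hε (hG ε)
      (le_mul_gridSize d L C hε) hf hO hV hK hQ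
    obtain ⟨post, hpost, hpost'⟩ := exists_layers_interpolate hy hy2 v fun n => hv n 0
    obtain ⟨η, hη, hη', hd⟩ := H _ (continuous_actLayers post) hpost'
    obtain ⟨pre, hpre, hpre'⟩ := exists_layers_encode hη hη' ((L + 3) * gridSize d L C ε)
      (labelCoeff d L (gridSize d L C ε))
    refine ⟨⟨pre, A, post⟩, shiftEmbedding d L, hA, ?_, ?_⟩
    · rw [TransformerA.numFF, hpre, hpost, card_nodes]
      nlinarith [Nat.mul_le_mul_left (d * (L + 3)) (hpow ε).1, Nat.mul_le_mul_left d (hpow ε).2]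
    · refine (dAlpha_congr fun Z hZ => ?_).trans_le hd
      simp only [TransformerA.eval, evalLayers_eq_mapCols]
      rw [mapCols_congr hpre' (add_shiftEmbedding_nonneg hZ)]
      rfl
  · obtain ⟨A, y, v, hA, hy, -, -, H⟩ := exists_head_and_nodes hα hC hε (hG ε)
      (le_mul_gridSize d L C hε) hf hO hV hK hQ
    obtain ⟨F₂, hF₂⟩ := exists_feedForward_interpolate
      (r := (d + 3 * (d * (L + 3)) + 3 * L) * gridSize d L C ε ^ (d * L))
      (by rw [card_nodes, ← mul_assoc]; exact Nat.mul_le_mul_right _ (Nat.le_add_left _ _)) hy v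
    obtain ⟨η, hη, hη', hd⟩ := H _ F₂.continuous_act hF₂
    obtain ⟨F₁, hF₁⟩ := exists_feedForward_encode
      (r := (d + 3 * (d * (L + 3)) + 3 * L) * gridSize d L C ε ^ (d * L))
      (1 / gridSize d L C ε) η ((L + 3) * gridSize d L C ε)
      (labelCoeff d L (gridSize d L C ε))
      (by nlinarith [Nat.mul_le_mul_left (3 * (d * (L + 3))) (hpow ε).1,
        Nat.mul_le_mul_left d (hpow ε).2])
    refine ⟨⟨F₁, A, F₂⟩, shiftEmbedding d L, hA, ?_⟩
    refine (dAlpha_congr fun Z hZ => ?_).trans_le hd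
    simp only [TransformerB.eval, FeedForward.eval_eq_mapCols]
    rw [mapCols_congr hF₁ (add_shiftEmbedding_nonneg hZ)]
    rfl
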